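/- Let $\Sigma$ be a finite alphabet and $R$ an arbitrary set of weights. An $R$-weighted automaton is a tuple $\mathcal A=(Q,\Sigma,\Delta,\mathrm{wgt},I,F)$ with $Q$ a finite set of states, $\Delta\subseteq Q\times\Sigma\times Q$, $\mathrm{wgt}\colon\Delta\to R$ and $I,F\subseteq Q$. Its semantics $[\![\mathcal A]\!]$ maps each nonempty word $u\in\Sigma^+$ to the finite multiset of the weight sequences $\mathrm{wgt}(\delta_1)\cdots\mathrm{wgt}(\delta_n)$ of all successful runs $\delta_1\cdots\delta_n$ (that is, runs leading from a state in $I$ to a state in $F$) with label $u$. The automaton is *aperiodic* if there is $m\ge 1$ such that for all $p,q\in Q$ and all $u\in\Sigma^+$ there is a run from $p$ to $q$ with label $u^m$ if and only if there is one with label $u^{m+1}$. It is *unambiguous* if every $u\in\Sigma^+$ has at most one successful run, and *finitely ambiguous* if there is a constant $k$ such that every $u\in\Sigma^+$ has at most $k$ successful runs. Weighted first-order logic wFO has the following syntax, with $a\in\Sigma$, $r\in R$ and $x,y$ first-order variables: $$\varphi::=\top\mid P_a(x)\mid x\le y\mid\neg\varphi\mid\varphi\wedge\varphi\mid\forall x\,\varphi,\qquad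 \Psi::=r\mid\varphi\,?\,\Psi:\Psi,\qquad \Phi::=\mathbf 0\mid\textstyle\prod_x\Psi\mid\varphi\,?\,\Phi:\Phi\mid\Phi+\Phi\mid\sum_x\Phi .$$ Let $u\in\Sigma^+$ be a nonempty word and let $\sigma$ map the variables to positions $1,\dots,|u|$ of $u$. The formulas $\varphi$ have the usual boolean semantics over words, a step formula $\Psi$ takes a value $[\![\Psi]\!](u,\sigma)\in R$, and a wFO formula $\Phi$ takes as value $[\![\Phi]\!](u,\sigma)$ a finite multiset of sequences over $R$: a constant $r$ has value $r$; if-then-else ($\varphi\,?\,\cdot:\cdot$) selects the first branch if $u,\sigma\models\varphi$ and the second otherwise; $[\![\mathbf 0]\!](u,\sigma)=\emptyset$; $[\![\prod_x\Psi]\!](u,\sigma)$ is the singleton multiset consisting of the sequence $r_1\cdots r_{|u|}$ with $r_i=[\![\Psi]\!](u,\sigma[x\mapsto i])$; $+$ is multiset union; and $[\![\sum_x\Phi]\!](u,\sigma)$ is the multiset union over all positions $i$ of $u$ of $[\![\Phi]\!](u,\sigma[x\mapsto i])$. A sentence is a wFO formula without free variables; its value does not depend on $\sigma$ and is written $[\![\Phi]\!](u)$.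 Let $\mathcal A$ be an aperiodic $R$-weighted automaton over $\Sigma$. 1. If $\mathcal A$ is unambiguous, then there is a wFO sentence $\Phi$ which uses neither a first-order sum $\sum_x$ nor the operator $+$, such that $[\![\mathcal A]\!](u)=[\![\Phi]\!](u)$ for all $u\in\Sigma^+$. 2. If $\mathcal A$ is finitely ambiguous, then there is a wFO sentence $\Phi$ which does not use any first-order sum $\sum_x$, such that $[\![\mathcal A]\!](u)=[\![\Phi]\!](u)$ for all $u\in\Sigma^+$. -/

import Mathlib

/-! ### Non-deterministic and weighted automata

Words over `α` are lists; the words of `Σ⁺` are the nonempty lists. -/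

/-- A non-deterministic automaton `(Q, Σ, Δ)`. Finiteness of `Q` and of `Σ = α` is imposed by
instance arguments where it is used. -/
structure NDAutomaton (α Q : Type*) where
  /-- The set `Δ ⊆ Q × Σ × Q` of transitions. -/
  trans : Set (Q × α × Q)

namespace NDAutomaton

variable {α Q : Type*}

/-- `A.IsRun p ρ q`: the sequence of transitions `ρ` is a run from `p` to `q`. The empty
sequence is the empty run from `p` to `p`, which is labelled by the empty word. -/
def IsRun (A : NDAutomaton α Q) : Q → List A.trans → Q → Prop
  | p, [], q => p = q
  | p, t :: ρ, q => t.1.1 = p ∧ A.IsRun t.1.2.2 ρ q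

/-- The label of a run. -/
def label (A : NDAutomaton α Q) (ρ : List A.trans) : List α :=
  ρ.map fun t => t.1.2.1

/-- The set of runs from `p` to `q` with label `u`. -/
def runs (A : NDAutomaton α Q) (p q : Q) (u : List α) : Set (List A.trans) :=
  {ρ | A.IsRun p ρ q ∧ A.label ρ = u}

/-- The language of labels of runs from `p` to `q`. -/
def lang (A : NDAutomaton α Q) (p q : Q) : Language α :=
  {u | ∃ ρ, ρ ∈ A.runs p q u}

/-- The automaton is aperiodic: for some `m ≥ 1`, all states `p, q` and all `u ∈ Σ⁺`, the word
`u ^ m` labels a run from `p` to `q` if and only if `u ^ (m + 1)` does. -/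
def IsAperiodic (A : NDAutomaton α Q) : Prop :=
  ∃ m : ℕ, 1 ≤ m ∧ ∀ (p q : Q) (u : List α), u ≠ [] →
    ((List.replicate m u).flatten ∈ A.lang p q ↔
      (List.replicate (m + 1) u).flatten ∈ A.lang p q)

/-- A word labels only finitely many runs. -/
theorem finite_runs [Finite α] [Finite Q] (A : NDAutomaton α Q) (p q : Q) (u : List α) :
    (A.runs p q u).Finite := by
  refine (List.finite_length_eq A.trans u.length).subset ?_
  rintro ρ ⟨-, h⟩
  simp [← h, label]

end NDAutomaton

/-- An `R`-weighted automaton `(Q, Σ, Δ, wgt, I, F)` over `Σ = α`, with initial and final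
states. -/
structure WeightedAutomaton (α R Q : Type*) extends NDAutomaton α Q where
  /-- The weight of each transition. -/
  wgt : trans → R
  /-- The initial states. -/
  init : Set Q
  /-- The final states. -/
  final : Set Q

namespace WeightedAutomaton

variable {α R Q : Type*}

/-- The successful runs with label `u`, i.e. those leading from an initial to a final state. -/
def successfulRuns (A : WeightedAutomaton α R Q) (u : List α) : Set (List A.trans) :=
  {ρ | ∃ p ∈ A.init, ∃ q ∈ A.final, ρ ∈ A.runs p q u}

/-- Every nonempty word has at most `k` successful runs. -/
def IsAmbiguousBy (A : WeightedAutomaton α R Q) (k : ℕ) : Prop :=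
  ∀ u : List α, u ≠ [] → (A.successfulRuns u).encard ≤ k

/-- Unambiguous: every nonempty word has at most one successful run. -/
def IsUnambiguous (A : WeightedAutomaton α R Q) : Prop :=
  A.IsAmbiguousBy 1

/-- Finitely ambiguous: the number of successful runs of a nonempty word is bounded by a
constant. -/
def IsFinitelyAmbiguous (A : WeightedAutomaton α R Q) : Prop :=
  ∃ k : ℕ, A.IsAmbiguousBy k

/-- The abstract semantics from `p` to `q`: the multiset of weight sequences of the runs from `p`
to `q` with label `u`. -/
noncomputable def semFrom [Finite α] [Finite Q] (A : WeightedAutomaton α R Q) (p q : Q)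
    (u : List α) : Multiset (List R) :=
  (A.finite_runs p q u).toFinset.val.map fun ρ => ρ.map A.wgt

/-- The abstract semantics: the multiset union, over all initial `p` and final `q`, of the
semantics from `p` to `q`. -/
noncomputable def sem [Finite α] [Finite Q] (A : WeightedAutomaton α R Q)
    (u : List α) : Multiset (List R) :=
  ∑ p ∈ A.init.toFinite.toFinset, ∑ q ∈ A.final.toFinite.toFinset, A.semFrom p q u

end WeightedAutomaton

/-! ### Weighted first-order logic

First-order variables are natural numbers. The positions of a word `u` are `Fin u.length`. A
valuation gives a position to every variable; only the values on the free variables of a formula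
matter for its semantics. -/

/-- Boolean first-order formulas over words. -/
inductive FO (α : Type*)
  | top : FO α
  | letter (a : α) (x : ℕ) : FO α
  | le (x y : ℕ) : FO α
  | neg (φ : FO α) : FO α
  | and (φ ψ : FO α) : FO α
  | all (x : ℕ) (φ : FO α) : FO α

namespace FO

variable {α : Type*}

/-- Free variables. -/
def freeVars : FO α → Finset ℕ
  | top => ∅
  | letter _ x => {x}
  | le x y => {x, y}
  | neg φ => φ.freeVars
  | and φ ψ => φ.freeVars ∪ ψ.freeVars
  | all x φ => φ.freeVars.erase x

/-- Satisfaction `u, σ ⊨ φ`. -/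
def Sat (u : List α) : (ℕ → Fin u.length) → FO α → Prop
  | _, top => True
  | σ, letter a x => u.get (σ x) = a
  | σ, le x y => σ x ≤ σ y
  | σ, neg φ => ¬ Sat u σ φ
  | σ, and φ ψ => Sat u σ φ ∧ Sat u σ ψ
  | σ, all x φ => ∀ i, Sat u (Function.update σ x i) φ

end FO

/-- Step formulas: constants `r` and if-then-else `φ ? Ψ₁ : Ψ₂`. -/
inductive StepFO (α R : Type*)
  | const (r : R) : StepFO α R
  | ite (φ : FO α) (Ψ₁ Ψ₂ : StepFO α R) : StepFO α R

namespace StepFO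

variable {α R : Type*}

/-- Free variables. -/
def freeVars : StepFO α R → Finset ℕ
  | const _ => ∅
  | ite φ Ψ₁ Ψ₂ => φ.freeVars ∪ Ψ₁.freeVars ∪ Ψ₂.freeVars

open Classical in
/-- The semantics of a step formula, a single weight. -/
noncomputable def sem (u : List α) (σ : ℕ → Fin u.length) : StepFO α R → R
  | const r => r
  | ite φ Ψ₁ Ψ₂ => if FO.Sat u σ φ then sem u σ Ψ₁ else sem u σ Ψ₂

end StepFO

/-- Weighted first-order formulas: `𝟎`, the product `∏ₓ Ψ` of a step formula, if-then-else
`φ ? Φ₁ : Φ₂`, binary sums `Φ₁ + Φ₂` and first-order sums `∑ₓ Φ`. -/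
inductive WFO (α R : Type*)
  | zero : WFO α R
  | prod (x : ℕ) (Ψ : StepFO α R) : WFO α R
  | ite (φ : FO α) (Φ₁ Φ₂ : WFO α R) : WFO α R
  | add (Φ₁ Φ₂ : WFO α R) : WFO α R
  | sum (x : ℕ) (Φ : WFO α R) : WFO α R

namespace WFO

variable {α R : Type*}

/-- Free variables. -/
def freeVars : WFO α R → Finset ℕ
  | zero => ∅
  | prod x Ψ => Ψ.freeVars.erase x
  | ite φ Φ₁ Φ₂ => φ.freeVars ∪ Φ₁.freeVars ∪ Φ₂.freeVars
  | add Φ₁ Φ₂ => Φ₁.freeVars ∪ Φ₂.freeVars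
  | sum x Φ => Φ.freeVars.erase x

/-- A sentence is a formula without free variables. -/
def IsSentence (Φ : WFO α R) : Prop := Φ.freeVars = ∅

/-- The formula does not use any first-order sum `∑ₓ`. -/
def NoFirstOrderSum : WFO α R → Prop
  | zero => True
  | prod _ _ => True
  | ite _ Φ₁ Φ₂ => Φ₁.NoFirstOrderSum ∧ Φ₂.NoFirstOrderSum
  | add Φ₁ Φ₂ => Φ₁.NoFirstOrderSum ∧ Φ₂.NoFirstOrderSum
  | sum _ _ => False

/-- The formula does not use any binary sum `+`. -/
def NoBinarySum : WFO α R → Prop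
  | zero => True
  | prod _ _ => True
  | ite _ Φ₁ Φ₂ => Φ₁.NoBinarySum ∧ Φ₂.NoBinarySum
  | add _ _ => False
  | sum _ Φ => Φ.NoBinarySum

open Classical in
/-- The abstract semantics of a weighted formula, a finite multiset of weight sequences. -/
noncomputable def sem (u : List α) : (ℕ → Fin u.length) → WFO α R → Multiset (List R)
  | _, zero => 0
  | σ, prod x Ψ => {List.ofFn fun i => Ψ.sem u (Function.update σ x i)}
  | σ, ite φ Φ₁ Φ₂ => if FO.Sat u σ φ then sem u σ Φ₁ else sem u σ Φ₂
  | σ, add Φ₁ Φ₂ => sem u σ Φ₁ + sem u σ Φ₂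
  | σ, sum x Φ => ∑ i, sem u (Function.update σ x i) Φ

end WFO

/-- A weighted automaton and a weighted sentence have the same abstract semantics `Σ⁺ → ℕ⟨R⁺⟩`.
The semantics of a sentence does not depend on the valuation, so equality is required for every
valuation (there is one, as `u` is nonempty). -/
def WeightedAutomaton.Equivalent {α R Q : Type*} [Finite α] [Finite Q]
    (A : WeightedAutomaton α R Q) (Φ : WFO α R) : Prop :=
  ∀ u : List α, u ≠ [] → ∀ σ : ℕ → Fin u.length, A.sem u = Φ.sem u σ

/-! Fix a linear order on the transitions and compare runs on the same word lexicographically. If a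
word has exactly j successful runs, they form a unique strictly increasing j-tuple, so the
transition taken by the i-th run at position x is determined by the word, i and x. Once it is
first-order definable that some increasing j-tuple of successful runs has δ at position x of its
i-th component, a step formula computes the weight at x, its product is the weight sequence of the
i-th run, and the sum over i is the semantics. The number j is found by testing for tuples of length
k, k - 1, and so on (`WeightedAutomaton.exists_sem_eq`); for k = 1 no `+` is needed.

Definability rests on two facts. The theorem `foDefinable_seg` shows that products in an aperiodic
monoid of maps of a finite set are first-order definable. Applied to the action of words on sets of
states, it shows that in an aperiodic automaton the prefixes and suffixes labelling runs between
given states are definable, hence so are the transitions that runs can take at a given position.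
Next, increasing tuples of runs are themselves the runs of an automaton `NDAutomaton.tuples`, which
remembers which pairs of runs already differ. That set of pairs only grows, so a long power of a
word contains a factor that leaves it unchanged, and aperiodicity is inherited
(`NDAutomaton.IsAperiodic.tuples`). -/

/-- A property of words and valuations is first-order definable. -/
def FODefinable {α : Type*} (P : ∀ u : List α, (ℕ → Fin u.length) → Prop) : Prop :=
  ∃ φ : FO α, ∀ u σ, FO.Sat u σ φ ↔ P u σ

/-! ### Closure properties of first-order definability. -/

namespace FODefinable

variable {α : Type*} {P P' : ∀ u : List α, (ℕ → Fin u.length) → Prop}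

theorem congr (h : FODefinable P) (e : ∀ u σ, P u σ ↔ P' u σ) : FODefinable P' := by
  obtain ⟨φ, hφ⟩ := h
  exact ⟨φ, fun u σ => (hφ u σ).trans (e u σ)⟩

theorem not (h : FODefinable P) : FODefinable fun u σ => ¬ P u σ := by
  obtain ⟨φ, hφ⟩ := h
  exact ⟨.neg φ, fun u σ => not_congr (hφ u σ)⟩

theorem and (h : FODefinable P) (h' : FODefinable P') :
    FODefinable fun u σ => P u σ ∧ P' u σ := by
  obtain ⟨φ, hφ⟩ := h
  obtain ⟨ψ, hψ⟩ := h'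
  exact ⟨.and φ ψ, fun u σ => and_congr (hφ u σ) (hψ u σ)⟩

theorem or (h : FODefinable P) (h' : FODefinable P') :
    FODefinable fun u σ => P u σ ∨ P' u σ :=
  (h.not.and h'.not).not.congr fun u σ => by tauto

theorem imp (h : FODefinable P) (h' : FODefinable P') :
    FODefinable fun u σ => P u σ → P' u σ :=
  (h.not.or h').congr fun u σ => by tauto

theorem const (p : Prop) : FODefinable fun (u : List α) (_ : ℕ → Fin u.length) => p := by
  by_cases hp : p
  · exact ⟨.top, fun u σ => by simp [FO.Sat, hp]⟩
  · exact ⟨.neg .top, fun u σ => by simp [FO.Sat, hp]⟩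

theorem le (x y : ℕ) : FODefinable fun (_ : List α) σ => σ x ≤ σ y :=
  ⟨.le x y, fun _ _ => Iff.rfl⟩

theorem lt (x y : ℕ) : FODefinable fun (_ : List α) σ => σ x < σ y :=
  (le y x).not.congr fun u σ => by simp

theorem eq (x y : ℕ) : FODefinable fun (_ : List α) σ => σ x = σ y :=
  ((le x y).and (le y x)).congr fun u σ => by simp [le_antisymm_iff]

theorem letter (a : α) (x : ℕ) : FODefinable fun (u : List α) σ => u.get (σ x) = a :=
  ⟨.letter a x, fun _ _ => Iff.rfl⟩

/-- The hypothesis `hz` makes z a fresh variable: it enters P only through the explicit position. -/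
theorem all (z : ℕ) {P : ∀ u : List α, (ℕ → Fin u.length) → Fin u.length → Prop}
    (h : FODefinable fun u σ => P u σ (σ z))
    (hz : ∀ u σ i j, P u (Function.update σ z i) j ↔ P u σ j) :
    FODefinable fun u σ => ∀ i, P u σ i := by
  obtain ⟨φ, hφ⟩ := h
  refine ⟨.all z φ, fun u σ => forall_congr' fun i => ?_⟩
  refine (hφ _ _).trans ((hz u σ i _).trans ?_)
  simp

theorem ex (z : ℕ) {P : ∀ u : List α, (ℕ → Fin u.length) → Fin u.length → Prop}
    (h : FODefinable fun u σ => P u σ (σ z))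
    (hz : ∀ u σ i j, P u (Function.update σ z i) j ↔ P u σ j) :
    FODefinable fun u σ => ∃ i, P u σ i :=
  (all z (P := fun u σ i => ¬ P u σ i) h.not fun u σ i j => not_congr (hz u σ i j)).not.congr
    fun u σ => by simp

theorem exists_finite {S : Type*} [Finite S]
    {P : S → ∀ u : List α, (ℕ → Fin u.length) → Prop} (h : ∀ s, FODefinable (P s)) :
    FODefinable fun u σ => ∃ s, P s u σ := by
  classical
  have key (t : Finset S) : FODefinable fun u σ => ∃ s ∈ t, P s u σ := by
    induction t using Finset.induction_on with
    | empty => exact (const False).congr fun u σ => by simp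
    | insert s t _ ih => exact ((h s).or ih).congr fun u σ => by simp
  cases nonempty_fintype S
  exact (key Finset.univ).congr fun u σ => by simp

theorem forall_finite {S : Type*} [Finite S]
    {P : S → ∀ u : List α, (ℕ → Fin u.length) → Prop} (h : ∀ s, FODefinable (P s)) :
    FODefinable fun u σ => ∀ s, P s u σ :=
  (exists_finite fun s => (h s).not).not.congr fun u σ => by simp

/-- A definable property which depends only on the variables in `V` is defined by a formula whose
free variables are in `V`. -/
theorem exists_freeVars_subset (h : FODefinable P) (V : Finset ℕ)
    (hV : ∀ u σ τ, (∀ x ∈ V, σ x = τ x) → (P u σ ↔ P u τ)) :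
    ∃ φ : FO α, φ.freeVars ⊆ V ∧ ∀ u σ, FO.Sat u σ φ ↔ P u σ := by
  obtain ⟨φ, hφ⟩ := h
  have key (W : Finset ℕ) (hW : Disjoint W V) :
      ∃ ψ : FO α, ψ.freeVars ⊆ φ.freeVars \ W ∧ ∀ u σ, FO.Sat u σ ψ ↔ P u σ := by
    induction W using Finset.induction_on with
    | empty => exact ⟨φ, by simp, hφ⟩
    | insert x W _ ih =>
      rw [Finset.disjoint_insert_left] at hW
      obtain ⟨ψ, hψ, hs⟩ := ih hW.2
      refine ⟨.all x ψ, ?_, fun u σ => ?_⟩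
      · intro y hy
        simp only [FO.freeVars, Finset.mem_erase] at hy
        have := hψ hy.2
        simp_all
      · have e (i) : P u (Function.update σ x i) ↔ P u σ :=
          hV _ _ _ fun y hy => Function.update_of_ne (ne_of_mem_of_not_mem hy hW.1) _ _
        simp only [FO.Sat, hs, e]
        -- The position `σ 0` shows that the word is nonempty, so quantifying over an irrelevant
        -- variable changes nothing.
        exact ⟨fun h => h (σ 0), fun h _ => h⟩
  obtain ⟨ψ, hψ, hs⟩ := key (φ.freeVars \ V) Finset.sdiff_disjoint
  exact ⟨ψ, fun y hy => by have := Finset.mem_sdiff.1 (hψ hy); simp_all, hs⟩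

end FODefinable

/-! ### Sequences of maps -/

/-- The composite of the maps `f i` for `a ≤ i < b`, the map `f a` being applied first. -/
def seg {S : Type*} (f : ℕ → S → S) (a : ℕ) : ℕ → S → S
  | 0 => id
  | b + 1 => if a ≤ b then f b ∘ seg f a b else id

section seg

variable {S : Type*} {f g : ℕ → S → S} {a b c : ℕ}

theorem seg_of_le (h : b ≤ a) : seg f a b = id := by
  cases b with
  | zero => rfl
  | succ b => simp [seg, Nat.not_le.2 h]

theorem seg_succ (h : a ≤ b) : seg f a (b + 1) = f b ∘ seg f a b := by
  simp [seg, h]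

theorem seg_comp (hab : a ≤ b) (hbc : b ≤ c) : seg f b c ∘ seg f a b = seg f a c := by
  induction c, hbc using Nat.le_induction with
  | base => simp [seg_of_le le_rfl]
  | succ c hbc ih => rw [seg_succ hbc, seg_succ (hab.trans hbc), Function.comp_assoc, ih]

theorem seg_eq_comp (hab : a < b) : seg f a b = seg f (a + 1) b ∘ f a := by
  rw [← seg_comp a.le_succ hab, seg_succ le_rfl, seg_of_le le_rfl, Function.comp_id]

theorem seg_congr (h : ∀ i, a ≤ i → i < b → f i = g i) : seg f a b = seg g a b := by
  induction b with
  | zero => rfl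
  | succ b ih =>
    simp only [seg]
    split_ifs with hab
    · rw [h b hab b.lt_succ_self, ih fun i hi hib => h i hi (hib.trans b.lt_succ_self)]
    · rfl

theorem seg_eq_id (h : ∀ i, a ≤ i → i < b → f i = id) : seg f a b = id := by
  induction b with
  | zero => rfl
  | succ b ih =>
    simp only [seg]
    split_ifs with hab
    · rw [h b hab b.lt_succ_self, ih fun i hi hib => h i hi (hib.trans b.lt_succ_self)]
      rfl
    · rfl

theorem seg_mem {M : Set (S → S)} (hid : id ∈ M) (hcomp : ∀ f ∈ M, ∀ g ∈ M, f ∘ g ∈ M)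
    (hf : ∀ i, f i ∈ M) : seg f a b ∈ M := by
  induction b with
  | zero => exact hid
  | succ b ih =>
    simp only [seg]
    split_ifs
    · exact hcomp _ (hf b) _ ih
    · exact hid

theorem seg_mapsTo {T : Set S} (hf : ∀ i, Set.MapsTo (f i) T T) :
    Set.MapsTo (seg f a b) T T :=
  seg_mem (M := {g | Set.MapsTo g T T}) (Set.mapsTo_id T) (fun _ hf _ hg => hf.comp hg) hf

theorem exists_last_lt {C : ℕ → Prop} {n : ℕ} (h : ∃ l < n, C l) :
    ∃ l < n, C l ∧ ∀ i, l < i → i < n → ¬ C i := by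
  induction n with
  | zero => simp at h
  | succ n ih =>
    by_cases hn : C n
    · exact ⟨n, n.lt_succ_self, hn, fun i h1 h2 => by omega⟩
    · obtain ⟨l, hl, hC⟩ := h
      have hln : l ≠ n := fun e => hn (e ▸ hC)
      obtain ⟨l, hl, hC, h⟩ := ih ⟨l, by omega, hC⟩
      refine ⟨l, by omega, hC, fun i h1 h2 => ?_⟩
      rcases (Nat.lt_succ_iff.1 h2).eq_or_lt with rfl | h2
      · exact hn
      · exact h i h1 h2

/-- Between two positions of `C`, the maps `f i` may be composed block by block, where a block ends
with a position of `C`. -/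
theorem seg_eqOn_blocks {f' G : ℕ → S → S} {C : ℕ → Prop} {d : S → S} {T : Set S}
    (hT : ∀ i, Set.MapsTo (f i) T T) (hC : ∀ i, C i → Set.EqOn (f i) d T)
    (hf' : ∀ i, ¬ C i → f' i = f i) (hG : ∀ i, ¬ C i → G i = id)
    (hGC : ∀ l n, l < n → C l → C n → (∀ i, l < i → i < n → ¬ C i) →
      G n = d ∘ seg f' (l + 1) n) {y z : ℕ} (hyz : y ≤ z) (hy : C y) (hz : C z) :
    Set.EqOn (seg f (y + 1) (z + 1)) (seg G (y + 1) (z + 1)) T := by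
  induction z using Nat.strong_induction_on with
  | _ z ih =>
    rcases hyz.eq_or_lt with rfl | hlt
    · simp only [seg_of_le le_rfl]
      exact fun _ _ => rfl
    -- The last block consists of the positions after l up to z; it is split off and the induction
    -- handles the rest.
    obtain ⟨l, hlz, hl, hno⟩ := exists_last_lt ⟨y, hlt, hy⟩
    have hyl : y ≤ l := by
      by_contra! h
      exact hno y h hlt hy
    intro s hs
    rw [← seg_comp (f := f) (Nat.succ_le_succ hyl) (Nat.succ_le_succ hlz.le),
      ← seg_comp (f := G) (Nat.succ_le_succ hyl) (Nat.succ_le_succ hlz.le)]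
    simp only [Function.comp_apply, Nat.succ_eq_add_one]
    rw [← ih l hlz hyl hl hs]
    have hs' : seg f (y + 1) (l + 1) s ∈ T := seg_mapsTo hT hs
    rw [seg_succ (Nat.succ_le_of_lt hlz), seg_succ (Nat.succ_le_of_lt hlz),
      seg_eq_id (f := G) (fun i h1 h2 => hG i (hno i h1 h2)), hGC l z hlz hl hz hno,
      seg_congr (f := f') (g := f) (fun i h1 h2 => hf' i (hno i h1 h2))]
    exact hC z hz (seg_mapsTo hT hs')

/-- If `y` is the first and `z` the last position of `C` with `a ≤ y ≤ z < b`, then the composite of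
the maps `f i` for `a ≤ i < b` may be computed block by block. -/
theorem seg_eq_of_blocks {f' G : ℕ → S → S} {C : ℕ → Prop} {d : S → S} {T : Set S}
    (hT : ∀ i, Set.MapsTo (f i) T T) (hC : ∀ i, C i → Set.EqOn (f i) d T)
    (hf' : ∀ i, ¬ C i → f' i = f i) (hG : ∀ i, ¬ C i → G i = id)
    (hGC : ∀ l n, l < n → C l → C n → (∀ i, l < i → i < n → ¬ C i) →
      G n = d ∘ seg f' (l + 1) n) {y z : ℕ} (hay : a ≤ y) (hyz : y ≤ z) (hzb : z < b)
    (hy : C y) (hz : C z) (hy' : ∀ i, a ≤ i → i < y → ¬ C i)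
    (hz' : ∀ i, z < i → i < b → ¬ C i) {s : S} (hs : s ∈ T) :
    seg f a b s = seg f' (z + 1) b (seg G (y + 1) b (d (seg f' a y s))) := by
  have e : seg G (y + 1) b = seg G (y + 1) (z + 1) := by
    rw [← seg_comp (Nat.succ_le_succ hyz) (Nat.succ_le_of_lt hzb),
      seg_eq_id (a := z.succ) fun i h1 h2 => hG i (hz' i h1 h2), Function.id_comp]
  have hs' : seg f a y s ∈ T := seg_mapsTo hT hs
  rw [e, seg_congr (f := f') (g := f) (fun i h1 h2 => hf' i (hz' i h1 h2)),
    seg_congr (f := f') (g := f) (fun i h1 h2 => hf' i (hy' i h1 h2)), ← hC y hy hs',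
    ← seg_eqOn_blocks hT hC hf' hG hGC hyz hy hz (hT y hs'),
    ← seg_comp hay (hyz.trans hzb.le), seg_eq_comp (hyz.trans_lt hzb),
    ← seg_comp (Nat.succ_le_succ hyz) (Nat.succ_le_of_lt hzb)]
  rfl

end seg

/-! ### First-order definability of products in an aperiodic monoid of maps. -/

/-- If the maps labelling the positions are definable and generate an aperiodic monoid, then so is
the composite of the labels of the positions strictly between two positions. -/
theorem foDefinable_seg {α S : Type*} [Finite S] {M : Set (S → S)} (hid : id ∈ M)
    (hcomp : ∀ f ∈ M, ∀ g ∈ M, f ∘ g ∈ M) (hap : ∀ f ∈ M, ∃ m : ℕ, f^[m + 1] = f^[m]) (T : Set S) :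
    ∀ F : List α → ℕ → S → S, (∀ u n, F u n ∈ M) → (∀ u n, Set.MapsTo (F u n) T T) →
      (∀ s ∈ T, ∀ t x, FODefinable fun u σ => F u (σ x) s = t) →
      ∀ s ∈ T, ∀ t x y, FODefinable fun u σ => seg (F u) (σ x + 1) (σ y) s = t := by
  classical
  induction T using WellFoundedLT.induction with
  | ind T ihT =>
  -- Inside the induction on the set T acted upon, a second induction runs on Γ, which lists the
  -- possible actions on T other than the identity.
  suffices H : ∀ Γ : Finset (S → S),
      ∀ F : List α → ℕ → S → S, (∀ u n, F u n ∈ M) → (∀ u n, Set.MapsTo (F u n) T T) →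
      (∀ s ∈ T, ∀ t x, FODefinable fun u σ => F u (σ x) s = t) →
      (∀ u n, Set.EqOn (F u n) id T ∨ ∃ g ∈ Γ, Set.EqOn (F u n) g T) →
      ∀ s ∈ T, ∀ t x y, FODefinable fun u σ => seg (F u) (σ x + 1) (σ y) s = t by
    intro F hM hT hF
    cases nonempty_fintype S
    exact H Finset.univ F hM hT hF fun u n => .inr ⟨_, Finset.mem_univ _, fun _ _ => rfl⟩
  intro Γ
  induction Γ using Finset.induction_on with
  | empty =>
    intro F hM hT hF hΓ s hs t x y
    have e (u : List α) (a b : ℕ) : seg (F u) a b s = s :=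
      seg_mem (M := {g | g s = s}) rfl (fun f hf g hg => by simp_all)
        (fun i => by simpa using (hΓ u i).resolve_right (by simp) hs)
    exact (FODefinable.const (s = t)).congr fun u σ => by rw [e]
  | insert c Γ _ ihΓ =>
    intro F hM hT hF hΓ
    by_cases hc : ∃ u n, Set.EqOn (F u n) c T ∧ ¬ Set.EqOn c id T
    swap
    · push Not at hc
      refine ihΓ F hM hT hF fun u n => (hΓ u n).elim .inl ?_
      rintro ⟨g, hg, he⟩
      rcases Finset.mem_insert.1 hg with rfl | hg
      · exact .inl (he.trans (hc u n he))
      · exact .inr ⟨g, hg, he⟩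
    obtain ⟨u₀, n₀, hdc, hcid⟩ := hc
    set d := F u₀ n₀
    have hdM : d ∈ M := hM u₀ n₀
    have hdT : Set.MapsTo d T T := hT u₀ n₀
    have hdid : ¬ Set.EqOn d id T := fun h => hcid (hdc.symm.trans h)
    have hsub : d '' T ⊆ T := hdT.image_subset
    have hss : d '' T < T := by
      refine lt_of_le_of_ne hsub fun he => hdid ?_
      -- If d maps T onto T, then so does d^m; since d fixes every value of d^m, it is the identity
      -- on T. Hence a nontrivial d shrinks T strictly.
      obtain ⟨m, hm⟩ := hap d hdM
      have him (n : ℕ) : d^[n] '' T = T := by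
        induction n with
        | zero => simp
        | succ n ih => rw [Function.iterate_succ, Set.image_comp, he, ih]
      intro s hs
      rw [← him m] at hs
      obtain ⟨r, -, rfl⟩ := hs
      have := congrFun hm r
      rwa [Function.iterate_succ_apply'] at this
    set C : List α → ℕ → Prop := fun u n => Set.EqOn (F u n) d T with hCdef
    set F' : List α → ℕ → S → S := fun u n => if C u n then id else F u n with hF'def
    have hF'M (u n) : F' u n ∈ M := by
      simp only [F']
      split_ifs
      exacts [hid, hM u n]
    have hF'T (u n) : Set.MapsTo (F' u n) T T := by
      simp only [F']
      split_ifs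
      exacts [Set.mapsTo_id T, hT u n]
    have defC (x) : FODefinable fun u σ => C u (σ x) :=
      (FODefinable.forall_finite fun s : T => hF s s.2 (d s) x).congr
        fun u σ => by simp [hCdef, Set.EqOn]
    have defF' : ∀ s ∈ T, ∀ t x, FODefinable fun u σ => F' u (σ x) s = t := by
      intro s hs t x
      refine (((defC x).and (.const (s = t))).or ((defC x).not.and (hF s hs t x))).congr
        fun u σ => ?_
      by_cases h : C u (σ x) <;> simp [hF'def, h]
    -- Erasing the positions that act as d removes c from the list of actions, so products inside a
    -- block are definable by the inner induction.
    have segF' := ihΓ F' hF'M hF'T defF' fun u n => by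
      by_cases h : C u n
      · left
        simp [hF'def, h, Set.eqOn_refl]
      · simp only [hF'def, h, if_false]
        refine (hΓ u n).imp_right ?_
        rintro ⟨g, hg, he⟩
        rcases Finset.mem_insert.1 hg with rfl | hg
        · exact absurd (he.trans hdc.symm) h
        · exact ⟨g, hg, he⟩
    have defNo (x y) : FODefinable fun u σ => ∀ w : Fin u.length, σ x < w → w < σ y → ¬ C u w := by
      refine FODefinable.all (x + y + 1)
        ((FODefinable.lt _ _).imp ((FODefinable.lt _ _).imp (defC _).not)) fun u σ i j => ?_
      have hx : x ≠ x + y + 1 := by omega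
      have hy : y ≠ x + y + 1 := by omega
      simp only [Function.update_of_ne hx, Function.update_of_ne hy]
    let last (u : List α) (l n : ℕ) : Prop :=
      l < n ∧ C u l ∧ C u n ∧ ∀ i, l < i → i < n → ¬ C u i
    have last_unique {u l l' n} (h : last u l n) (h' : last u l' n) : l = l' := by
      rcases lt_trichotomy l l' with hl | hl | hl
      · exact absurd h'.2.1 (h.2.2.2 l' hl h'.1)
      · exact hl
      · exact absurd h.2.1 (h'.2.2.2 l hl h.1)
    -- The map at a position of C is the action of the whole block ending there. It ends with d, so
    -- it preserves `d '' T`, to which the outer induction applies. The first position of C gets the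
    -- identity, as no block precedes it.
    let G : List α → ℕ → S → S := fun u n =>
      if h : ∃ l, last u l n then d ∘ seg (F' u) (h.choose + 1) n else id
    have G_last {u l n} (h : last u l n) : G u n = d ∘ seg (F' u) (l + 1) n := by
      have hex : ∃ l, last u l n := ⟨l, h⟩
      simp only [G, hex, dif_pos]
      rw [last_unique hex.choose_spec h]
    have G_not {u n} (h : ¬ ∃ l, last u l n) : G u n = id := by
      simp only [G, h, dif_neg, not_false_eq_true]
    have hGM (u n) : G u n ∈ M := by
      by_cases h : ∃ l, last u l n
      · obtain ⟨l, h⟩ := h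
        rw [G_last h]
        exact hcomp _ hdM _ (seg_mem hid hcomp (hF'M u))
      · rwa [G_not h]
    have hGT (u n) : Set.MapsTo (G u n) (d '' T) (d '' T) := by
      by_cases h : ∃ l, last u l n
      · obtain ⟨l, h⟩ := h
        rw [G_last h]
        exact fun s hs => ⟨_, seg_mapsTo (hF'T u) (hsub hs), rfl⟩
      · rw [G_not h]
        exact Set.mapsTo_id _
    have defLast (x y) : FODefinable fun u σ => last u (σ x) (σ y) := by
      refine ((FODefinable.lt x y).and ((defC x).and ((defC y).and (defNo x y)))).congr
        fun u σ => and_congr Iff.rfl (and_congr Iff.rfl (and_congr Iff.rfl ?_))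
      exact ⟨fun h i h1 h2 => h ⟨i, h2.trans (σ y).2⟩ h1 h2, fun h w h1 h2 => h w h1 h2⟩
    have defG : ∀ s ∈ d '' T, ∀ t x, FODefinable fun u σ => G u (σ x) s = t := by
      intro s hs t x
      have hx : x ≠ x + 1 := by omega
      have h1 : FODefinable fun u σ => ∃ l : Fin u.length, last u l (σ x) ∧
          ∃ r : S, seg (F' u) (l + 1) (σ x) s = r ∧ d r = t :=
        FODefinable.ex (x + 1) ((defLast _ _).and (FODefinable.exists_finite fun r =>
          (segF' s (hsub hs) r _ _).and (.const _))) fun u σ i j => by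
            simp only [Function.update_of_ne hx]
      have h2 : FODefinable fun u σ => ∃ l : Fin u.length, last u l (σ x) :=
        FODefinable.ex (x + 1) (defLast _ _) fun u σ i j => by
          simp only [Function.update_of_ne hx]
      refine (h1.or (h2.not.and (.const (s = t)))).congr fun u σ => ?_
      by_cases h : ∃ l : Fin u.length, last u l (σ x)
      · obtain ⟨l, hl⟩ := h
        rw [G_last hl]
        constructor
        · rintro (⟨l', hl', r, hr, hd⟩ | ⟨h, -⟩)
          · rw [last_unique hl hl', Function.comp_apply, hr, hd]
          · exact absurd ⟨l, hl⟩ h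
        · exact fun h => .inl ⟨l, hl, _, rfl, h⟩
      · have h' : ¬ ∃ l, last u l (σ x) := fun ⟨l, hl⟩ => h ⟨⟨l, hl.1.trans (σ x).2⟩, hl⟩
        rw [G_not h']
        constructor
        · rintro (⟨l, hl, -⟩ | ⟨-, h⟩)
          · exact absurd ⟨l, hl⟩ h
          · exact h
        · exact fun hst => .inr ⟨h, hst⟩
    have segG := ihT (d '' T) hss G hGM hGT defG
    intro s hs t x y
    have hx : x ≠ x + y + 1 := by omega
    have hy : y ≠ x + y + 1 := by omega
    have hx' : x ≠ x + y + 2 := by omega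
    have hy' : y ≠ x + y + 2 := by omega
    have hxy : x + y + 1 ≠ x + y + 2 := by omega
    -- Here p and q are the first and last positions of C strictly between x and y. The product of G
    -- starts after p, so no block reaching back to x or before it is involved.
    have hD : FODefinable fun u σ => ∃ p q : Fin u.length, (σ x < p ∧ p ≤ q ∧ q < σ y) ∧
        (C u p ∧ C u q) ∧ ((∀ w : Fin u.length, σ x < w → w < p → ¬ C u w) ∧
          (∀ w : Fin u.length, q < w → w < σ y → ¬ C u w)) ∧
        ∃ (r : T) (r' : ↥(d '' T)), seg (F' u) (σ x + 1) p s = r ∧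
          seg (G u) (p + 1) (σ y) (d r) = r' ∧ seg (F' u) (q + 1) (σ y) r' = t := by
      refine FODefinable.ex (x + y + 1) (FODefinable.ex (x + y + 2) ?_ ?_) ?_
      · exact ((FODefinable.lt _ _).and ((FODefinable.le _ _).and (FODefinable.lt _ _))).and
          (((defC _).and (defC _)).and (((defNo _ _).and (defNo _ _)).and
            (FODefinable.exists_finite fun r => FODefinable.exists_finite fun r' =>
              (segF' s hs r _ _).and ((segG (d r) ⟨r, r.2, rfl⟩ r' _ _).and
                (segF' r' (hsub r'.2) t _ _)))))
      · intro u σ i j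
        simp only [Function.update_of_ne hx', Function.update_of_ne hy', Function.update_of_ne hxy]
      · intro u σ i j
        simp only [Function.update_of_ne hx, Function.update_of_ne hy]
    refine (((defNo x y).and (segF' s hs t x y)).or hD).congr fun u σ => ?_
    have key (p q : ℕ) (h : (σ x : ℕ) + 1 ≤ p ∧ p ≤ q ∧ q < σ y) (hC : C u p ∧ C u q)
        (h1 : ∀ i : ℕ, (σ x : ℕ) + 1 ≤ i → i < p → ¬ C u i) (h2 : ∀ i : ℕ, q < i → i < σ y → ¬ C u i) :=
      seg_eq_of_blocks (f := F u) (f' := F' u) (G := G u) (C := C u) (hT u) (fun i hi => hi)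
        (fun i hi => if_neg hi) (fun i hi => G_not fun ⟨l, hl⟩ => hi hl.2.2.1)
        (fun l n h1 h2 h3 h4 => G_last ⟨h1, h2, h3, h4⟩) h.1 h.2.1 h.2.2 hC.1 hC.2 h1 h2 hs
    by_cases hno : ∀ w : Fin u.length, σ x < w → w < σ y → ¬ C u w
    · have e : seg (F' u) (σ x + 1) (σ y) = seg (F u) (σ x + 1) (σ y) :=
        seg_congr fun i h1 h2 => if_neg (hno ⟨i, h2.trans (σ y).2⟩ h1 h2)
      rw [e]
      constructor
      · rintro (⟨-, h⟩ | ⟨p, q, h, hC, -⟩)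
        · exact h
        · exact absurd hC.1 (hno p h.1 (h.2.1.trans_lt h.2.2))
      · exact fun h => .inl ⟨hno, h⟩
    · constructor
      · rintro (⟨h, -⟩ | ⟨p, q, h, hC, ⟨h1, h2⟩, r, r', e1, e2, e3⟩)
        · exact absurd h hno
        · rw [key p q h hC (fun i hi hi' => h1 ⟨i, hi'.trans p.2⟩ hi hi')
            (fun i hi hi' => h2 ⟨i, hi'.trans (σ y).2⟩ hi hi'), e1, e2, e3]
      · intro ht
        push Not at hno
        obtain ⟨w, hw1, hw2, hwC⟩ := hno
        obtain ⟨q, hq, hqC, hql⟩ := exists_last_lt (C := C u) ⟨w, hw2, hwC⟩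
        have hp : ∃ p : ℕ, (σ x : ℕ) < p ∧ C u p := ⟨w, hw1, hwC⟩
        have hwq : (w : ℕ) ≤ q := by
          by_contra! h
          exact hql w h hw2 hwC
        have hpw : Nat.find hp ≤ w := Nat.find_min' hp ⟨hw1, hwC⟩
        have hps := Nat.find_spec hp
        have hpm (i : ℕ) (h1 : (σ x : ℕ) < i) (h2 : i < Nat.find hp) : ¬ C u i :=
          fun h => Nat.find_min hp h2 ⟨h1, h⟩
        have hk := key (Nat.find hp) q ⟨hps.1, hpw.trans hwq, hq⟩ ⟨hps.2, hqC⟩ hpm hql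
        have hr : seg (F' u) (σ x + 1) (Nat.find hp) s ∈ T := seg_mapsTo (hF'T u) hs
        exact .inr ⟨⟨Nat.find hp, hpw.trans_lt w.2⟩, ⟨q, hq.trans (σ y).2⟩,
          ⟨hps.1, hpw.trans hwq, hq⟩, ⟨hps.2, hqC⟩,
          ⟨fun i h1 h2 => hpm i h1 h2, fun i h1 h2 => hql i h1 h2⟩, ⟨_, hr⟩,
          ⟨_, seg_mapsTo (hGT u) ⟨_, hr, rfl⟩⟩, rfl, rfl, hk ▸ ht⟩

/-! ### Runs of an aperiodic automaton and their first-order definability. -/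

namespace NDAutomaton

variable {α Q : Type*} {A : NDAutomaton α Q}

theorem mem_lang_nil {p q : Q} : [] ∈ A.lang p q ↔ p = q := by
  constructor
  · rintro ⟨ρ, h, hρ⟩
    obtain rfl : ρ = [] := by simpa [label] using hρ
    exact h
  · exact fun h => ⟨[], h, rfl⟩

theorem mem_lang_cons {p q : Q} {a : α} {u : List α} :
    a :: u ∈ A.lang p q ↔ ∃ r, (p, a, r) ∈ A.trans ∧ u ∈ A.lang r q := by
  constructor
  · rintro ⟨_ | ⟨⟨⟨p', a', r⟩, ht⟩, ρ⟩, h, hρ⟩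
    · simp [label] at hρ
    · simp only [label, List.map_cons, List.cons.injEq] at hρ
      obtain ⟨rfl, h⟩ := h
      obtain ⟨rfl, hρ⟩ := hρ
      exact ⟨r, ht, ρ, h, hρ⟩
  · rintro ⟨r, ht, ρ, h, hρ⟩
    exact ⟨⟨_, ht⟩ :: ρ, ⟨rfl, h⟩, congrArg (a :: ·) hρ⟩

theorem mem_lang_append {p q : Q} {u v : List α} :
    u ++ v ∈ A.lang p q ↔ ∃ r, u ∈ A.lang p r ∧ v ∈ A.lang r q := by
  induction u generalizing p with
  | nil => simp [mem_lang_nil]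
  | cons a u ih =>
    simp only [List.cons_append, mem_lang_cons, ih]
    constructor
    · rintro ⟨s, hs, r, h1, h2⟩
      exact ⟨r, ⟨s, hs, h1⟩, h2⟩
    · rintro ⟨r, ⟨s, hs, h1⟩, h2⟩
      exact ⟨s, hs, r, h1, h2⟩

theorem isRun_append {p q : Q} {ρ τ : List A.trans} :
    A.IsRun p (ρ ++ τ) q ↔ ∃ r, A.IsRun p ρ r ∧ A.IsRun r τ q := by
  induction ρ generalizing p with
  | nil => simp [IsRun]
  | cons t ρ ih => simp [IsRun, ih, and_assoc]

theorem length_eq_of_mem_runs {p q : Q} {u : List α} {ρ : List A.trans} (h : ρ ∈ A.runs p q u) :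
    ρ.length = u.length := by
  simp [← h.2, label]

/-- The word `u ^ n`. -/
def wordPow (u : List α) (n : ℕ) : List α := (List.replicate n u).flatten

theorem wordPow_add (u : List α) (m n : ℕ) : wordPow u (m + n) = wordPow u m ++ wordPow u n := by
  rw [wordPow, List.replicate_add, List.flatten_append, wordPow, wordPow]

theorem wordPow_one (u : List α) : wordPow u 1 = u := by simp [wordPow]

theorem wordPow_ne_nil {u : List α} (hu : u ≠ []) {n : ℕ} (hn : n ≠ 0) : wordPow u n ≠ [] := by
  obtain ⟨n, rfl⟩ := Nat.exists_eq_succ_of_ne_zero hn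
  rw [Nat.succ_eq_one_add, wordPow_add, wordPow_one]
  simp [hu]

/-- The set of states which may be reached from `X` by a run labelled by `u`. -/
def reach (A : NDAutomaton α Q) (u : List α) (X : Set Q) : Set Q :=
  {q | ∃ p ∈ X, u ∈ A.lang p q}

theorem reach_nil : A.reach [] = id := by
  ext X q
  simp [reach, mem_lang_nil]

theorem reach_append (u v : List α) : A.reach (u ++ v) = A.reach v ∘ A.reach u := by
  ext X q
  simp only [reach, mem_lang_append, Set.mem_ofPred_eq, Function.comp_apply]
  constructor
  · rintro ⟨p, hp, r, h1, h2⟩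
    exact ⟨r, ⟨p, hp, h1⟩, h2⟩
  · rintro ⟨r, ⟨p, hp, h1⟩, h2⟩
    exact ⟨p, hp, r, h1, h2⟩

theorem reach_wordPow (u : List α) (n : ℕ) : A.reach (wordPow u n) = (A.reach u)^[n] := by
  induction n with
  | zero => simp [wordPow, reach_nil]
  | succ n ih => rw [wordPow_add, wordPow_one, reach_append, ih, Function.iterate_succ']

theorem IsAperiodic.iterate_reach (hA : A.IsAperiodic) (u : List α) :
    ∃ m : ℕ, (A.reach u)^[m + 1] = (A.reach u)^[m] := by
  rcases eq_or_ne u [] with rfl | hu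
  · exact ⟨0, by simp [reach_nil]⟩
  · obtain ⟨m, -, h⟩ := hA
    refine ⟨m, ?_⟩
    rw [← reach_wordPow, ← reach_wordPow]
    ext X q
    simp only [reach, Set.mem_ofPred_eq, wordPow, h _ _ u hu]

/-- The action on sets of states of the letter at position `n` of `u`. -/
def letterReach (A : NDAutomaton α Q) (u : List α) (n : ℕ) : Set Q → Set Q :=
  A.reach u[n]?.toList

theorem seg_letterReach {u : List α} {a b : ℕ} (hb : b ≤ u.length) :
    seg (A.letterReach u) a b = A.reach ((u.take b).drop a) := by
  induction b with
  | zero => simp [seg, reach_nil]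
  | succ b ih =>
    by_cases hab : a ≤ b
    · rw [seg_succ hab, ih (by omega), letterReach, ← reach_append, List.take_add_one,
        List.drop_append_of_le_length (by simp; omega)]
    · rw [seg_of_le (by omega), List.drop_eq_nil_of_le (by simp; omega), reach_nil]

/-- Cutting a run at a transition leaves two independent runs, so only the prefix and the suffix
matter. -/
theorem exists_mem_runs_getElem?_iff {p q : Q} {u : List α} {n : ℕ} (hn : n < u.length)
    {τ : A.trans} : (∃ ρ ∈ A.runs p q u, ρ[n]? = some τ) ↔
      u.take n ∈ A.lang p τ.1.1 ∧ u[n] = τ.1.2.1 ∧ u.drop (n + 1) ∈ A.lang τ.1.2.2 q := by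
  constructor
  · rintro ⟨ρ, ⟨hr, rfl⟩, hτ⟩
    obtain ⟨hn', rfl⟩ := List.getElem?_eq_some_iff.1 hτ
    have e : ρ = ρ.take n ++ ρ[n] :: ρ.drop (n + 1) := by simp
    rw [e, isRun_append] at hr
    obtain ⟨r, h1, rfl, h2⟩ := hr
    exact ⟨⟨_, h1, by simp [label]⟩, by simp [label], ⟨_, h2, by simp [label]⟩⟩
  · rintro ⟨⟨ρ, h1, e1⟩, e, ⟨ρ', h2, e2⟩⟩
    refine ⟨ρ ++ τ :: ρ', ⟨isRun_append.2 ⟨_, h1, rfl, h2⟩, ?_⟩, ?_⟩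
    · have : u = u.take n ++ u[n] :: u.drop (n + 1) := by simp
      rw [this, ← e1, ← e2, e]
      simp [label]
    · have : ρ.length = n := by
        rw [length_eq_of_mem_runs ⟨h1, e1⟩]
        simp [hn.le]
      rw [List.getElem?_append_right this.le]
      simp [this]

variable [Finite α]

theorem foDefinable_letterReach (X Y : Set Q) (x : ℕ) :
    FODefinable fun (u : List α) σ => A.letterReach u (σ x) X = Y := by
  refine (FODefinable.exists_finite fun a =>
    (FODefinable.letter a x).and (.const (A.reach [a] X = Y))).congr fun u σ => ?_
  simp [letterReach]

variable [Finite Q]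

theorem IsAperiodic.foDefinable_seg (hA : A.IsAperiodic) (X Y : Set Q) (x y : ℕ) :
    FODefinable fun u σ => seg (A.letterReach u) (σ x + 1) (σ y) X = Y := by
  refine _root_.foDefinable_seg (M := Set.range A.reach) ⟨[], reach_nil⟩ ?_ ?_ Set.univ _
    (fun u n => ⟨_, rfl⟩) (fun _ _ => Set.mapsTo_univ _ _)
    (fun X _ Y x => foDefinable_letterReach X Y x) X trivial Y x y
  · rintro _ ⟨u, rfl⟩ _ ⟨v, rfl⟩
    exact ⟨v ++ u, reach_append v u⟩
  · rintro _ ⟨u, rfl⟩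
    exact hA.iterate_reach u

/-- Definability of `seg` concerns the positions strictly between two positions, so the first letter
is applied separately and the empty prefix is a separate case. The suffix is treated symmetrically,
with the last letter. -/
theorem IsAperiodic.foDefinable_take (hA : A.IsAperiodic) (p q : Q) (x : ℕ) :
    FODefinable fun u σ => u.take (σ x) ∈ A.lang p q := by
  have hx : x ≠ x + 1 := by omega
  have first : FODefinable fun (u : List α) σ => ∀ z : Fin u.length, σ (x + 1) ≤ z :=
    FODefinable.all (x + 2) (.le _ _) fun u σ i j => by
      rw [Function.update_of_ne (by omega)]
  have h : FODefinable fun (u : List α) σ => ∃ z : Fin u.length,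
      (∀ w : Fin u.length, z ≤ w) ∧ ((z = σ x ∧ p = q) ∨ (z < σ x ∧ ∃ X Y : Set Q,
        A.letterReach u z {p} = X ∧ seg (A.letterReach u) (z + 1) (σ x) X = Y ∧ q ∈ Y)) := by
    refine FODefinable.ex (x + 1) (first.and ((FODefinable.and (.eq _ _) (.const _)).or
      ((FODefinable.lt _ _).and (.exists_finite fun X => .exists_finite fun Y =>
        (foDefinable_letterReach _ _ _).and ((hA.foDefinable_seg X Y _ _).and (.const _))))))
      fun u σ i j => ?_
    rw [Function.update_of_ne hx]
  refine h.congr fun u σ => ?_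
  have e : u.take (σ x) ∈ A.lang p q ↔ q ∈ seg (A.letterReach u) 0 (σ x) {p} := by
    rw [seg_letterReach (σ x).2.le]
    simp [reach]
  have h0 : 0 < u.length := (σ x).pos
  rw [e]
  constructor
  · rintro ⟨z, hz, ⟨hzx, rfl⟩ | ⟨hzx, X, Y, rfl, rfl, hq⟩⟩
    · have : (σ x : ℕ) = 0 := by
        have : z ≤ ⟨0, h0⟩ := hz _
        rw [← hzx]
        simpa [Fin.le_def] using this
      simp [this, seg]
    · have : (z : ℕ) = 0 := by
        have : z ≤ ⟨0, h0⟩ := hz _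
        simpa [Fin.le_def] using this
      rw [this] at hq
      rwa [seg_eq_comp (by rw [← this]; exact hzx)]
  · intro hq
    refine ⟨⟨0, h0⟩, fun w => Fin.mk_le_of_le_val (Nat.zero_le _), ?_⟩
    rcases Nat.eq_zero_or_pos (σ x) with hx | hx
    · left
      rw [hx] at hq
      exact ⟨Fin.ext hx.symm, by simpa [seg, eq_comm] using hq⟩
    · right
      rw [seg_eq_comp hx] at hq
      exact ⟨hx, _, _, rfl, rfl, hq⟩

theorem IsAperiodic.foDefinable_drop (hA : A.IsAperiodic) (p q : Q) (x : ℕ) :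
    FODefinable fun u σ => u.drop (σ x + 1) ∈ A.lang p q := by
  have hx : x ≠ x + 1 := by omega
  have final : FODefinable fun (u : List α) σ => ∀ z : Fin u.length, z ≤ σ (x + 1) :=
    FODefinable.all (x + 2) (.le _ _) fun u σ i j => by
      rw [Function.update_of_ne (by omega)]
  have h : FODefinable fun (u : List α) σ => ∃ z : Fin u.length,
      (∀ w : Fin u.length, w ≤ z) ∧ ((σ x = z ∧ p = q) ∨ (σ x < z ∧ ∃ X Y : Set Q,
        seg (A.letterReach u) (σ x + 1) z {p} = X ∧ A.letterReach u z X = Y ∧ q ∈ Y)) := by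
    refine FODefinable.ex (x + 1) (final.and ((FODefinable.and (.eq _ _) (.const _)).or
      ((FODefinable.lt _ _).and (.exists_finite fun X => .exists_finite fun Y =>
        (hA.foDefinable_seg _ X _ _).and ((foDefinable_letterReach _ _ _).and (.const _))))))
      fun u σ i j => ?_
    rw [Function.update_of_ne hx]
  refine h.congr fun u σ => ?_
  obtain ⟨n, hn⟩ : ∃ n, u.length = n + 1 := Nat.exists_eq_succ_of_ne_zero (σ x).pos.ne'
  have e : u.drop (σ x + 1) ∈ A.lang p q ↔
      q ∈ seg (A.letterReach u) (σ x + 1) (n + 1) {p} := by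
    rw [seg_letterReach hn.ge, ← hn]
    simp [reach]
  have hxn : (σ x : ℕ) ≤ n := by omega
  have hlast (z : Fin u.length) (hz : ∀ w, w ≤ z) : (z : ℕ) = n := by
    have : (⟨n, by omega⟩ : Fin u.length) ≤ z := hz _
    have : n ≤ z := this
    omega
  rw [e]
  constructor
  · rintro ⟨z, hz, ⟨hzx, rfl⟩ | ⟨hzx, X, Y, rfl, rfl, hq⟩⟩
    · rw [hzx, hlast z hz, seg_of_le le_rfl]
      rfl
    · rw [hlast z hz] at hq
      rw [seg_succ]
      · exact hq
      · rw [← hlast z hz]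
        exact hzx
  · intro hq
    refine ⟨⟨n, by omega⟩, fun w => by rw [Fin.le_def]; simp; omega, ?_⟩
    rcases hxn.eq_or_lt with hx | hx
    · left
      rw [hx, seg_of_le le_rfl] at hq
      exact ⟨Fin.ext hx, hq.symm⟩
    · right
      rw [seg_succ hx] at hq
      exact ⟨hx, _, _, rfl, rfl, hq⟩

theorem IsAperiodic.foDefinable_getElem? (hA : A.IsAperiodic) (p q : Q) (τ : A.trans) (x : ℕ) :
    FODefinable fun u σ => ∃ ρ ∈ A.runs p q u, ρ[(σ x : ℕ)]? = some τ := by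
  refine ((hA.foDefinable_take p τ.1.1 x).and ((FODefinable.letter τ.1.2.1 x).and
    (hA.foDefinable_drop τ.1.2.2 q x))).congr fun u σ => ?_
  rw [exists_mem_runs_getElem?_iff (σ x).2]
  rfl

theorem IsAperiodic.foDefinable_mem_lang (hA : A.IsAperiodic) (p q : Q) :
    FODefinable fun u _ => u ∈ A.lang p q := by
  -- The variable 0 is arbitrary: any run on u takes some transition at the position `σ 0`.
  refine (FODefinable.exists_finite fun τ => hA.foDefinable_getElem? p q τ 0).congr
    fun u σ => ?_
  constructor
  · rintro ⟨_, ρ, hρ, -⟩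
    exact ⟨ρ, hρ⟩
  · rintro ⟨ρ, hρ⟩
    have : (σ 0 : ℕ) < ρ.length := by
      rw [length_eq_of_mem_runs hρ]
      exact (σ 0).2
    exact ⟨_, ρ, hρ, List.getElem?_eq_getElem this⟩

end NDAutomaton

/-! ### Increasing tuples of runs -/

/-- The tuple `t` is weakly increasing on the pairs outside `D`, and `D'` consists of the pairs in `D`
and of those on which `t` is not constant. -/
def Separates {j : ℕ} {β : Type*} [LinearOrder β] (D D' : Set (Fin j × Fin j)) (t : Fin j → β) :
    Prop :=
  (∀ a b, a < b → (a, b) ∉ D → t a ≤ t b) ∧ D' = D ∪ {c | c.1 < c.2 ∧ t c.1 ≠ t c.2}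

theorem separates_nil {j : ℕ} {β : Type*} [LinearOrder β] {D D' : Set (Fin j × Fin j)} :
    Separates D D' (fun _ => ([] : List β)) ↔ D = D' := by
  simp [Separates, eq_comm]

theorem cons_le_cons_iff_lex {β : Type*} [LinearOrder β] {a b : β} {l m : List β} :
    a :: l ≤ b :: m ↔ a < b ∨ a = b ∧ l ≤ m := by
  rw [le_iff_lt_or_eq, le_iff_lt_or_eq, List.cons_lt_cons_iff, List.cons.injEq]
  tauto

/-- Lexicographic comparison is decided at the first difference: a pair separated by the heads is
free afterwards, and any other pair keeps its constraint. -/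
theorem separates_cons {j : ℕ} {β : Type*} [LinearOrder β] {D D' : Set (Fin j × Fin j)}
    {t : Fin j → β} {r : Fin j → List β} :
    Separates D D' (fun i => t i :: r i) ↔ ∃ E, Separates D E t ∧ Separates E D' r := by
  constructor
  · rintro ⟨h, rfl⟩
    refine ⟨_, ⟨fun a b hab hD => ?_, rfl⟩, fun a b hab hD => ?_, ?_⟩
    · rcases cons_le_cons_iff_lex.1 (h a b hab hD) with h | h
      exacts [h.le, h.1.le]
    · simp only [Set.mem_union, not_or, Set.mem_ofPred_eq, not_and, not_not] at hD
      rcases cons_le_cons_iff_lex.1 (h a b hab hD.1) with h | h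
      exacts [absurd (hD.2 hab) h.ne, h.2]
    · ext c
      simp only [Set.mem_union, Set.mem_ofPred_eq, ne_eq, List.cons.injEq]
      tauto
  · rintro ⟨E, ⟨h, rfl⟩, h', rfl⟩
    refine ⟨fun a b hab hD => cons_le_cons_iff_lex.2 ?_, ?_⟩
    · rcases (h a b hab hD).lt_or_eq with hlt | heq
      · exact .inl hlt
      · refine .inr ⟨heq, h' a b hab ?_⟩
        simp [hD, heq]
    · ext c
      simp only [Set.mem_union, Set.mem_ofPred_eq, ne_eq, List.cons.injEq]
      tauto

namespace NDAutomaton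

variable {α Q : Type*} {A : NDAutomaton α Q} {j : ℕ} [LinearOrder A.trans]

/-- The automaton whose runs are the lexicographically increasing `j`-tuples of runs of `A`. The
second component of a state is the set of those pairs of runs which already differ. -/
def tuples (A : NDAutomaton α Q) [LinearOrder A.trans] (j : ℕ) :
    NDAutomaton α ((Fin j → Q) × Set (Fin j × Fin j)) where
  trans := {x | ∃ t : Fin j → A.trans, (∀ i, (t i).1 = (x.1.1 i, x.2.1, x.2.2.1 i)) ∧
    Separates x.1.2 x.2.2.2 t}

/-- A component of a transition of the automaton of tuples. -/
def tuplesProj (i : Fin j) (τ : (A.tuples j).trans) : A.trans :=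
  ⟨(τ.1.1.1 i, τ.1.2.1, τ.1.2.2.1 i), by
    obtain ⟨t, h, -⟩ := τ.2
    rw [← h i]
    exact (t i).2⟩

theorem separates_tuplesProj (τ : (A.tuples j).trans) :
    Separates τ.1.1.2 τ.1.2.2.2 fun i => tuplesProj i τ := by
  obtain ⟨t, h, hs⟩ := τ.2
  have e : (fun i => tuplesProj i τ) = t := funext fun i => Subtype.ext (h i).symm
  rwa [e]

theorem of_isRun_tuples {P P' : (Fin j → Q) × Set (Fin j × Fin j)} {ρ : List (A.tuples j).trans}
    (h : (A.tuples j).IsRun P ρ P') :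
    (∀ i, A.IsRun (P.1 i) (ρ.map (tuplesProj i)) (P'.1 i)) ∧
      Separates P.2 P'.2 fun i => ρ.map (tuplesProj i) := by
  induction ρ generalizing P with
  | nil =>
    obtain rfl : P = P' := h
    exact ⟨fun i => rfl, separates_nil.2 rfl⟩
  | cons τ ρ ih =>
    obtain ⟨rfl, h⟩ := h
    obtain ⟨h1, h2⟩ := ih h
    exact ⟨fun i => ⟨rfl, h1 i⟩, separates_cons.2 ⟨_, separates_tuplesProj τ, h2⟩⟩

theorem of_mem_runs_tuples {P P' : (Fin j → Q) × Set (Fin j × Fin j)} {u : List α}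
    {ρ : List (A.tuples j).trans} (h : ρ ∈ (A.tuples j).runs P P' u) :
    (∀ i, ρ.map (tuplesProj i) ∈ A.runs (P.1 i) (P'.1 i) u) ∧
      Separates P.2 P'.2 fun i => ρ.map (tuplesProj i) := by
  obtain ⟨h1, h2⟩ := of_isRun_tuples h.1
  refine ⟨fun i => ⟨h1 i, ?_⟩, h2⟩
  rw [← h.2]
  simp [label, tuplesProj]

theorem exists_mem_runs_tuples {P P' : (Fin j → Q) × Set (Fin j × Fin j)} {u : List α}
    {r : Fin j → List A.trans} (hr : ∀ i, r i ∈ A.runs (P.1 i) (P'.1 i) u)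
    (hs : Separates P.2 P'.2 r) :
    ∃ ρ ∈ (A.tuples j).runs P P' u, ∀ i, ρ.map (tuplesProj i) = r i := by
  induction u generalizing P r with
  | nil =>
    have hr' (i) : r i = [] := by
      have := length_eq_of_mem_runs (hr i)
      simpa using this
    obtain rfl : r = fun _ => [] := funext hr'
    refine ⟨[], ⟨Prod.ext (funext fun i => (hr i).1) (separates_nil.1 hs), rfl⟩, fun i => rfl⟩
  | cons a u ih =>
    have hr' (i) : ∃ t l, r i = t :: l := by
      have := length_eq_of_mem_runs (hr i)
      exact List.exists_cons_of_length_eq_add_one this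
    choose t l htl using hr'
    obtain rfl : r = fun i => t i :: l i := funext htl
    obtain ⟨E, h1, h2⟩ := separates_cons.1 hs
    have hl (i) : (t i).1.2.1 = a ∧ A.label (l i) = u := by
      have := (hr i).2
      simpa [label] using this
    obtain ⟨ρ, hρ, he⟩ := ih (P := (fun i => (t i).1.2.2, E)) (r := l)
      (fun i => ⟨(hr i).1.2, (hl i).2⟩) h2
    have ht (i) : (t i).1 = (P.1 i, a, (t i).1.2.2) := by
      rw [← (hr i).1.1, ← (hl i).1]
    refine ⟨⟨(P, a, (fun i => (t i).1.2.2, E)), t, ht, h1⟩ :: ρ,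
      ⟨⟨rfl, hρ.1⟩, congrArg (a :: ·) hρ.2⟩, fun i => ?_⟩
    rw [List.map_cons, he i]
    exact congrArg (· :: l i) (Subtype.ext (ht i).symm)

theorem mem_lang_tuples {P P' : (Fin j → Q) × Set (Fin j × Fin j)} {u : List α} :
    u ∈ (A.tuples j).lang P P' ↔ ∃ r : Fin j → List A.trans,
      (∀ i, r i ∈ A.runs (P.1 i) (P'.1 i) u) ∧ Separates P.2 P'.2 r := by
  constructor
  · rintro ⟨ρ, hρ⟩
    exact ⟨_, of_mem_runs_tuples hρ⟩
  · rintro ⟨r, hr, hs⟩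
    obtain ⟨ρ, hρ, -⟩ := exists_mem_runs_tuples hr hs
    exact ⟨ρ, hρ⟩

omit [LinearOrder A.trans] in
theorem eq_of_isRun {p q p' q' : Q} {ρ : List A.trans} (hρ : ρ ≠ []) (h : A.IsRun p ρ q)
    (h' : A.IsRun p' ρ q') : p = p' ∧ q = q' := by
  induction ρ generalizing p p' with
  | nil => exact absurd rfl hρ
  | cons t ρ ih =>
    refine ⟨h.1.symm.trans h'.1, ?_⟩
    rcases eq_or_ne ρ [] with rfl | hρ
    · exact h.2.symm.trans h'.2
    · exact (ih hρ h.2 h'.2).2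

/-- If the set of separated pairs does not change, the runs of an unseparated pair coincide and
share their endpoints. Choosing one run on v for each pair of endpoints keeps them equal, while
separated pairs are unconstrained. -/
theorem mem_lang_tuples_of_eq {P P' : (Fin j → Q) × Set (Fin j × Fin j)} {u v : List α}
    (hu : u ≠ []) (huv : ∀ p q, u ∈ A.lang p q → v ∈ A.lang p q) (hP : P.2 = P'.2)
    (h : u ∈ (A.tuples j).lang P P') : v ∈ (A.tuples j).lang P P' := by
  classical
  obtain ⟨r, hr, hs⟩ := mem_lang_tuples.1 h
  let f (p q : Q) : List A.trans := if h : v ∈ A.lang p q then h.choose else []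
  have hf {p q} (h : v ∈ A.lang p q) : f p q ∈ A.runs p q v := by
    simp only [f, h, dif_pos]
    exact h.choose_spec
  have key (a b) (hab : a < b) (hD : (a, b) ∉ P.2) :
      f (P.1 a) (P'.1 a) = f (P.1 b) (P'.1 b) := by
    have hrab : r a = r b := by
      by_contra hne
      rw [hP, hs.2] at hD
      exact hD (.inr ⟨hab, hne⟩)
    have hne : r a ≠ [] := by
      rw [← List.length_pos_iff, length_eq_of_mem_runs (hr a)]
      exact List.length_pos_iff.2 hu
    obtain ⟨h1, h2⟩ := eq_of_isRun hne (hr a).1 (hrab ▸ (hr b).1)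
    rw [h1, h2]
  refine mem_lang_tuples.2 ⟨fun i => f (P.1 i) (P'.1 i), fun i => hf (huv _ _ ⟨_, hr i⟩),
    fun a b hab hD => (key a b hab hD).le, ?_⟩
  rw [← hP]
  refine (Set.union_eq_self_of_subset_right fun c hc => ?_).symm
  by_contra hD
  exact hc.2 (key _ _ hc.1 hD)

theorem subset_of_mem_lang_tuples {P P' : (Fin j → Q) × Set (Fin j × Fin j)} {u : List α}
    (h : u ∈ (A.tuples j).lang P P') : P.2 ⊆ P'.2 := by
  obtain ⟨r, -, hs⟩ := mem_lang_tuples.1 h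
  rw [hs.2]
  exact Set.subset_union_left

/-- A long power labels a run of the automaton of tuples which reads one of the factors without
changing the set of separated pairs. -/
theorem exists_factor_or_ncard_le {v : List α} {N : ℕ}
    {P P' : (Fin j → Q) × Set (Fin j × Fin j)} (h : wordPow v N ∈ (A.tuples j).lang P P') :
    (∃ s t, s + 1 + t = N ∧ ∃ S S', wordPow v s ∈ (A.tuples j).lang P S ∧
      v ∈ (A.tuples j).lang S S' ∧ wordPow v t ∈ (A.tuples j).lang S' P' ∧ S.2 = S'.2) ∨
    N + P.2.ncard ≤ P'.2.ncard := by
  induction N generalizing P with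
  | zero =>
    right
    rw [zero_add]
    exact Set.ncard_le_ncard (subset_of_mem_lang_tuples h)
  | succ N ih =>
    rw [add_comm, wordPow_add, wordPow_one, mem_lang_append] at h
    obtain ⟨S, h1, h2⟩ := h
    by_cases hS : P.2 = S.2
    · exact .inl ⟨0, N, by omega, P, S, mem_lang_nil.2 rfl, h1, h2, hS⟩
    -- A factor that changes the set of separated pairs enlarges it, and thus pays for itself in
    -- cardinality.
    have hlt := Set.ncard_lt_ncard ((subset_of_mem_lang_tuples h1).ssubset_of_ne hS)
    rcases ih h2 with ⟨s, t, hst, S1, S2, h3, h4, h5, he⟩ | hle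
    · refine .inl ⟨1 + s, t, by omega, S1, S2, ?_, h4, h5, he⟩
      rw [wordPow_add, wordPow_one, mem_lang_append]
      exact ⟨S, h1, h3⟩
    · right
      omega

omit [LinearOrder A.trans] in
theorem wordPow_wordPow (u : List α) (m n : ℕ) : wordPow (wordPow u m) n = wordPow u (m * n) := by
  induction n with
  | zero => rfl
  | succ n ih => rw [wordPow_add, ih, wordPow_one, mul_add, mul_one, wordPow_add]

theorem wordPow_mem_lang_tuples {w : List α} (hw : w ≠ []) {m n N : ℕ} (hN : j * j ≤ N)
    (hmn : ∀ p q, wordPow w (m + 1) ∈ A.lang p q → wordPow w n ∈ A.lang p q)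
    {P P' : (Fin j → Q) × Set (Fin j × Fin j)}
    (h : wordPow w ((m + 1) * (N + 1)) ∈ (A.tuples j).lang P P') :
    wordPow w ((m + 1) * N + n) ∈ (A.tuples j).lang P P' := by
  -- Of the N + 1 copies of w^(m+1), more than the j * j possible pairs, one leaves the set of
  -- separated pairs unchanged; it is replaced by w^n.
  rw [← wordPow_wordPow] at h
  rcases exists_factor_or_ncard_le h with ⟨s, t, hst, S, S', h1, h2, h3, he⟩ | hle
  · obtain rfl : s + t = N := by omega
    have e : (m + 1) * (s + t) + n = (m + 1) * s + (n + (m + 1) * t) := by ring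
    rw [e, wordPow_add, wordPow_add, ← wordPow_wordPow, ← wordPow_wordPow, mem_lang_append]
    refine ⟨S, h1, mem_lang_append.2 ⟨S', ?_, h3⟩⟩
    exact mem_lang_tuples_of_eq (wordPow_ne_nil hw m.succ_ne_zero) hmn he h2
  · have := Set.ncard_le_card P'.2
    simp only [Nat.card_eq_fintype_card, Fintype.card_prod, Fintype.card_fin] at this
    omega

theorem IsAperiodic.tuples (hA : A.IsAperiodic) (j : ℕ) : (A.tuples j).IsAperiodic := by
  obtain ⟨m, -, hm⟩ := hA
  -- This index provides j * j + 1 copies of w^(m+1). Replacing one of them by w^(m+2) lengthens the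
  -- power by one.
  refine ⟨(m + 1) * (j * j + 1), Nat.mul_pos m.succ_pos (Nat.succ_pos _), fun P P' w hw => ⟨fun h => ?_, fun h => ?_⟩⟩
  · refine wordPow_mem_lang_tuples hw le_rfl (n := m + 2) (fun p q h => ?_) h
    rw [wordPow_add, wordPow_one, mem_lang_append] at h
    obtain ⟨r, h1, h2⟩ := h
    have e : m + 2 = m + 1 + 1 := rfl
    rw [e, wordPow_add, wordPow_one]
    exact mem_lang_append.2 ⟨r, (hm _ _ w hw).1 h1, h2⟩
  · change wordPow w _ ∈ _ at h
    -- One copy of w is set aside; in the rest, a factor w^(m+1) is replaced by w^m.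
    rw [add_comm, wordPow_add, wordPow_one, mem_lang_append] at h
    obtain ⟨S, h1, h2⟩ := h
    have h3 := wordPow_mem_lang_tuples hw le_rfl (n := m) (fun p q h => (hm p q w hw).2 h) h2
    change wordPow w _ ∈ _
    have e : (m + 1) * (j * j + 1) = 1 + ((m + 1) * (j * j) + m) := by ring
    rw [e, wordPow_add, wordPow_one]
    exact mem_lang_append.2 ⟨S, h1, h3⟩

end NDAutomaton

/-! ### Successful runs and their increasing enumeration. -/

namespace WeightedAutomaton

variable {α R Q : Type*} {A : WeightedAutomaton α R Q}

theorem finite_successfulRuns [Finite α] [Finite Q] (A : WeightedAutomaton α R Q) (u : List α) :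
    (A.successfulRuns u).Finite := by
  refine (List.finite_length_eq A.trans u.length).subset ?_
  rintro ρ ⟨p, -, q, -, h⟩
  exact NDAutomaton.length_eq_of_mem_runs h

/-- The semantics of an automaton in terms of an enumeration of the successful runs. -/
theorem sem_eq_sum [Finite α] [Finite Q] {u : List α} (hu : u ≠ []) {j : ℕ}
    {r : Fin j → List A.trans} (hinj : Function.Injective r)
    (hr : Set.range r = A.successfulRuns u) : A.sem u = ∑ i, {(r i).map A.wgt} := by
  classical
  -- A nonempty run determines its endpoints, so no run is counted for two pairs of states.
  have eq_of {p q p' q' : Q} {ρ} (h : ρ ∈ A.runs p q u) (h' : ρ ∈ A.runs p' q' u) :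
      p = p' ∧ q = q' := by
    refine NDAutomaton.eq_of_isRun ?_ h.1 h'.1
    rw [← List.length_pos_iff, NDAutomaton.length_eq_of_mem_runs h]
    exact List.length_pos_iff.2 hu
  have e (p q : Q) : A.semFrom p q u =
      ∑ ρ ∈ (A.finite_runs p q u).toFinset, {ρ.map A.wgt} := by
    rw [semFrom, Finset.sum, ← Multiset.sum_map_singleton (Multiset.map _ _), Multiset.map_map]
    rfl
  simp only [sem, e]
  have h1 (p : Q) : ∑ q ∈ A.final.toFinite.toFinset,
      ∑ ρ ∈ (A.finite_runs p q u).toFinset, ({ρ.map A.wgt} : Multiset (List R)) =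
      ∑ ρ ∈ A.final.toFinite.toFinset.biUnion fun q => (A.finite_runs p q u).toFinset,
        {ρ.map A.wgt} := by
    refine (Finset.sum_biUnion fun q _ q' _ hne => Finset.disjoint_left.2 fun ρ h h' => hne ?_).symm
    exact (eq_of ((Set.Finite.mem_toFinset _).1 h) ((Set.Finite.mem_toFinset _).1 h')).2
  simp only [h1]
  rw [← Finset.sum_biUnion]
  · rw [← Finset.sum_image (g := r) (s := Finset.univ) (f := fun ρ => {ρ.map A.wgt}) hinj.injOn]
    refine Finset.sum_congr ?_ fun _ _ => rfl
    ext ρ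
    have : ρ ∈ Set.range r ↔ ρ ∈ A.successfulRuns u := by rw [hr]
    simpa [successfulRuns] using this.symm
  · intro p _ p' _ hne
    refine Finset.disjoint_left.2 fun ρ h h' => hne ?_
    simp only [Finset.mem_biUnion, Set.Finite.mem_toFinset] at h h'
    obtain ⟨q, -, h⟩ := h
    obtain ⟨q', -, h'⟩ := h'
    exact (eq_of h h').1

variable [LinearOrder A.trans] {j : ℕ}

/-- `r` is an increasing tuple of successful runs on `u`. -/
def IsRunTuple (A : WeightedAutomaton α R Q) [LinearOrder A.trans] {j : ℕ} (u : List α)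
    (r : Fin j → List A.trans) : Prop :=
  StrictMono r ∧ ∀ i, r i ∈ A.successfulRuns u

/-- A finite set has only one increasing enumeration. This makes the existential statement about
tuples describe the i-th run. -/
theorem IsRunTuple.eq_of_range_eq {u : List α} {r r' : Fin j → List A.trans}
    (hr : StrictMono r) (hru : Set.range r = A.successfulRuns u) (hr' : A.IsRunTuple u r') :
    r' = r := by
  classical
  have hc : (Finset.univ.image r).card = j := by
    simp [Finset.card_image_of_injective _ hr.injective]
  rw [Finset.orderEmbOfFin_unique hc (f := r) (by simp) hr]
  refine Finset.orderEmbOfFin_unique hc (fun i => ?_) hr'.1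
  have : r' i ∈ Set.range r := hru ▸ hr'.2 i
  simpa using this

theorem exists_isRunTuple_of_ncard [Finite α] [Finite Q] {u : List α}
    (h : (A.successfulRuns u).ncard = j) :
    ∃ r : Fin j → List A.trans, A.IsRunTuple u r ∧ Set.range r = A.successfulRuns u := by
  have hc : (A.finite_successfulRuns u).toFinset.card = j := by
    rw [← h, Set.ncard_eq_toFinset_card _ (A.finite_successfulRuns u)]
  have hr : Set.range ((A.finite_successfulRuns u).toFinset.orderEmbOfFin hc) =
      A.successfulRuns u := by simp
  exact ⟨_, ⟨OrderEmbedding.strictMono _, fun i => hr.subset ⟨i, rfl⟩⟩, hr⟩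

/-- The initial states of the automaton of tuples. -/
def IsTupleInit (A : WeightedAutomaton α R Q) {j : ℕ} (P : (Fin j → Q) × Set (Fin j × Fin j)) :
    Prop :=
  (∀ i, P.1 i ∈ A.init) ∧ P.2 = ∅

/-- The final states of the automaton of tuples. -/
def IsTupleFinal (A : WeightedAutomaton α R Q) {j : ℕ} (P : (Fin j → Q) × Set (Fin j × Fin j)) :
    Prop :=
  (∀ i, P.1 i ∈ A.final) ∧ P.2 = {c | c.1 < c.2}

theorem separates_empty_iff {β : Type*} [LinearOrder β] {t : Fin j → β} :
    Separates ∅ {c | c.1 < c.2} t ↔ StrictMono t := by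
  simp only [Separates, Set.mem_empty_iff_false, not_false_eq_true, true_implies, Set.empty_union]
  constructor
  · rintro ⟨h, he⟩ a b hab
    have hmem : (a, b) ∈ {c : Fin j × Fin j | c.1 < c.2} := hab
    rw [he] at hmem
    exact lt_of_le_of_ne (h a b hab) hmem.2
  · refine fun h => ⟨fun a b hab => (h hab).le, Set.ext fun c => ⟨fun hc => ⟨hc, (h hc).ne⟩, ?_⟩⟩
    exact fun hc => hc.1

theorem isRunTuple_of_mem_runs {P P' : (Fin j → Q) × Set (Fin j × Fin j)} {u : List α}
    (hP : A.IsTupleInit P) (hP' : A.IsTupleFinal P')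
    {ρ : List (A.toNDAutomaton.tuples j).trans} (h : ρ ∈ (A.toNDAutomaton.tuples j).runs P P' u) :
    A.IsRunTuple u fun i => ρ.map (NDAutomaton.tuplesProj i) := by
  obtain ⟨h1, h2⟩ := NDAutomaton.of_mem_runs_tuples h
  rw [hP.2, hP'.2] at h2
  exact ⟨separates_empty_iff.1 h2, fun i => ⟨_, hP.1 i, _, hP'.1 i, h1 i⟩⟩

theorem IsRunTuple.exists_mem_runs {u : List α} {r : Fin j → List A.trans}
    (h : A.IsRunTuple u r) :
    ∃ P P', A.IsTupleInit P ∧ A.IsTupleFinal P' ∧ ∃ ρ ∈ (A.toNDAutomaton.tuples j).runs P P' u,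
      ∀ i, ρ.map (NDAutomaton.tuplesProj i) = r i := by
  choose p hp q hq hr using h.2
  exact ⟨(p, ∅), (q, {c | c.1 < c.2}), ⟨hp, rfl⟩, ⟨hq, rfl⟩,
    NDAutomaton.exists_mem_runs_tuples hr (separates_empty_iff.2 h.1)⟩

variable [Finite α] [Finite Q]

theorem foDefinable_exists_isRunTuple (hA : A.IsAperiodic) (j : ℕ) :
    FODefinable fun u _ => ∃ r : Fin j → List A.trans, A.IsRunTuple u r := by
  refine (FODefinable.exists_finite fun P => FODefinable.exists_finite fun P' =>
    (FODefinable.const (A.IsTupleInit P ∧ A.IsTupleFinal P')).and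
      ((hA.tuples j).foDefinable_mem_lang P P')).congr fun u σ => ?_
  constructor
  · rintro ⟨P, P', ⟨hP, hP'⟩, ρ, hρ⟩
    exact ⟨_, isRunTuple_of_mem_runs hP hP' hρ⟩
  · rintro ⟨r, hr⟩
    obtain ⟨P, P', hP, hP', ρ, hρ, -⟩ := hr.exists_mem_runs
    exact ⟨P, P', ⟨hP, hP'⟩, ρ, hρ⟩

theorem foDefinable_isRunTuple_getElem? (hA : A.IsAperiodic) (i : Fin j) (δ : A.trans) (x : ℕ) :
    FODefinable fun u σ => ∃ r : Fin j → List A.trans,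
      A.IsRunTuple u r ∧ (r i)[(σ x : ℕ)]? = some δ := by
  refine (FODefinable.exists_finite fun P => FODefinable.exists_finite fun P' =>
    FODefinable.exists_finite fun τ => (FODefinable.const (A.IsTupleInit P ∧ A.IsTupleFinal P' ∧
      NDAutomaton.tuplesProj i τ = δ)).and
      ((hA.tuples j).foDefinable_getElem? P P' τ x)).congr fun u σ => ?_
  constructor
  · rintro ⟨P, P', τ, ⟨hP, hP', rfl⟩, ρ, hρ, hτ⟩
    exact ⟨_, isRunTuple_of_mem_runs hP hP' hρ, by simp [hτ]⟩
  · rintro ⟨r, hr, hδ⟩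
    obtain ⟨P, P', hP, hP', ρ, hρ, he⟩ := hr.exists_mem_runs
    rw [← he i, List.getElem?_map, Option.map_eq_some_iff] at hδ
    obtain ⟨τ, hτ, rfl⟩ := hδ
    exact ⟨P, P', τ, ⟨hP, hP', rfl⟩, ρ, hρ, hτ⟩

end WeightedAutomaton

/-! ### Construction of the weighted sentence. -/

/-- Selection among finitely many weights by mutually exclusive conditions. -/
theorem StepFO.exists_sem_eq {α R D : Type*} [Finite D] [Nonempty R] (φ : D → FO α) (w : D → R)
    {V : Finset ℕ} (hV : ∀ d, (φ d).freeVars ⊆ V) :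
    ∃ Ψ : StepFO α R, Ψ.freeVars ⊆ V ∧ ∀ u σ d, (∀ d', FO.Sat u σ (φ d') ↔ d' = d) →
      Ψ.sem u σ = w d := by
  classical
  cases nonempty_fintype D
  have key (l : List D) : ∃ Ψ : StepFO α R, Ψ.freeVars ⊆ V ∧
      ∀ u σ, ∀ d ∈ l, (∀ d', FO.Sat u σ (φ d') ↔ d' = d) → Ψ.sem u σ = w d := by
    induction l with
    -- The default weight is never used when some d in the list is selected.
    | nil => exact ⟨.const (Classical.arbitrary R), by simp [freeVars], by simp⟩
    | cons e l ih =>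
      obtain ⟨Ψ, h1, h2⟩ := ih
      refine ⟨.ite (φ e) (.const (w e)) Ψ, ?_, fun u σ d hd h => ?_⟩
      · simp [freeVars, Finset.union_subset_iff, hV, h1]
      · by_cases he : e = d
        · simp [sem, h, he]
        · simp only [sem, h, he, if_false]
          exact h2 u σ d ((List.mem_cons.1 hd).resolve_left (Ne.symm he)) h
  obtain ⟨Ψ, h1, h2⟩ := key Finset.univ.toList
  exact ⟨Ψ, h1, fun u σ d => h2 u σ d (by simp)⟩

namespace WeightedAutomaton

variable {α R Q : Type*} {A : WeightedAutomaton α R Q} [Finite α] [Finite Q]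

theorem exists_prod_sem_eq [LinearOrder A.trans] [Nonempty R] (hA : A.IsAperiodic) {j : ℕ}
    (i : Fin j) :
    ∃ Ψ : StepFO α R, Ψ.freeVars ⊆ {0} ∧ ∀ u (r : Fin j → List A.trans), StrictMono r →
      Set.range r = A.successfulRuns u → ∀ σ, (WFO.prod 0 Ψ).sem u σ = {(r i).map A.wgt} := by
  have h (δ : A.trans) := (foDefinable_isRunTuple_getElem? hA i δ 0).exists_freeVars_subset {0}
    fun u σ τ h => by rw [h 0 (by simp)]
  choose φ hφ hs using h
  obtain ⟨Ψ, h1, h2⟩ := StepFO.exists_sem_eq φ A.wgt hφ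
  refine ⟨Ψ, h1, fun u r hr hru σ => ?_⟩
  have hri (i) : r i ∈ A.successfulRuns u := hru ▸ ⟨i, rfl⟩
  have hlen : (r i).length = u.length := by
    obtain ⟨p, -, q, -, h⟩ := hri i
    exact NDAutomaton.length_eq_of_mem_runs h
  rw [WFO.sem]
  congr 1
  refine List.ext_getElem (by simp [hlen]) fun n hn hn' => ?_
  have hn : n < (r i).length := by simpa using hn'
  rw [List.getElem_ofFn, List.getElem_map]
  refine h2 _ _ _ fun δ => ?_
  rw [hs, Function.update_self]
  constructor
  · rintro ⟨r', hr', hδ⟩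
    obtain rfl := hr'.eq_of_range_eq hr hru
    rw [List.getElem?_eq_getElem hn] at hδ
    exact (Option.some.inj hδ).symm
  · rintro rfl
    exact ⟨r, ⟨hr, hri⟩, List.getElem?_eq_getElem hn⟩

end WeightedAutomaton

/-- Finite nonempty sums of weighted formulas, without `+` if there is only one summand. -/
theorem WFO.exists_sem_eq_sum {α R : Type*} {n : ℕ} (Θ : Fin (n + 1) → WFO α R)
    (hΘ : ∀ i, (Θ i).IsSentence ∧ (Θ i).NoFirstOrderSum ∧ (Θ i).NoBinarySum) :
    ∃ Φ : WFO α R, Φ.IsSentence ∧ Φ.NoFirstOrderSum ∧ (n = 0 → Φ.NoBinarySum) ∧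
      ∀ u σ, Φ.sem u σ = ∑ i, (Θ i).sem u σ := by
  induction n with
  | zero => exact ⟨Θ 0, (hΘ 0).1, (hΘ 0).2.1, fun _ => (hΘ 0).2.2, fun u σ => by simp⟩
  | succ n ih =>
    obtain ⟨Φ, h1, h2, -, h3⟩ := ih (fun i => Θ i.castSucc) fun i => hΘ _
    have hl := hΘ (Fin.last _)
    refine ⟨.add Φ (Θ (Fin.last _)), ?_, ⟨h2, hl.2.1⟩, by simp, fun u σ => ?_⟩
    · simp only [IsSentence, freeVars] at h1 hl ⊢
      simp [h1, hl]
    · rw [sem, h3, Fin.sum_univ_castSucc (n := n + 1)]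

theorem WeightedAutomaton.exists_sem_eq {α R Q : Type*} [Finite α] [Finite Q]
    {A : WeightedAutomaton α R Q} (hA : A.IsAperiodic) [Nonempty R] (k : ℕ) :
    ∃ Φ : WFO α R, Φ.IsSentence ∧ Φ.NoFirstOrderSum ∧ (k ≤ 1 → Φ.NoBinarySum) ∧
      ∀ u : List α, u ≠ [] → (A.successfulRuns u).ncard ≤ k → ∀ σ, A.sem u = Φ.sem u σ := by
  -- Any linear order serves; it only numbers the runs.
  let _ : LinearOrder A.trans :=
    LinearOrder.lift' (Finite.equivFin A.trans) (Finite.equivFin A.trans).injective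
  induction k with
  | zero =>
    refine ⟨.zero, rfl, trivial, fun _ => trivial, fun u hu hk σ => ?_⟩
    obtain ⟨r, hr, hru⟩ := exists_isRunTuple_of_ncard (Nat.le_zero.1 hk)
    rw [sem_eq_sum hu hr.1.injective hru, WFO.sem]
    simp
  | succ k ih =>
    obtain ⟨Φ, h1, h2, h3, h4⟩ := ih
    obtain ⟨χ, hχ, hs⟩ := (foDefinable_exists_isRunTuple hA (k + 1)).exists_freeVars_subset ∅
      fun _ _ _ _ => Iff.rfl
    choose Ψ hΨ hsem using fun i : Fin (k + 1) => exists_prod_sem_eq hA i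
    obtain ⟨Θ, t1, t2, t3, t4⟩ := WFO.exists_sem_eq_sum (fun i => WFO.prod 0 (Ψ i)) fun i =>
      ⟨by simpa [WFO.IsSentence, WFO.freeVars, Finset.erase_eq_empty_iff,
        Finset.subset_singleton_iff] using hΨ i, trivial, trivial⟩
    -- The test χ says that there are at least k + 1 successful runs. If it holds, the bound makes
    -- the tuple exhaust them; otherwise at most k remain for Φ.
    refine ⟨.ite χ Θ Φ, ?_, ⟨t2, h2⟩, fun hk => ⟨t3 (by omega), h3 (by omega)⟩,
      fun u hu hk σ => ?_⟩
    · simp only [WFO.IsSentence, WFO.freeVars] at h1 t1 ⊢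
      simp [h1, t1, Finset.subset_empty.1 hχ]
    · have hfin := A.finite_successfulRuns u
      rw [WFO.sem, hs]
      split_ifs with h
      · obtain ⟨r, hr⟩ := h
        have hru : Set.range r = A.successfulRuns u := by
          refine Set.eq_of_subset_of_ncard_le (Set.range_subset_iff.2 hr.2) ?_ hfin
          rw [Set.ncard_range_of_injective hr.1.injective]
          simpa using hk
        rw [sem_eq_sum hu hr.1.injective hru, t4]
        exact Finset.sum_congr rfl fun i _ => (hsem i u r hr.1 hru σ).symm
      · refine h4 u hu (Nat.lt_succ_iff.1 (lt_of_le_of_ne hk fun he => h ?_)) σ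
        obtain ⟨r, hr, -⟩ := exists_isRunTuple_of_ncard he
        exact ⟨r, hr⟩

theorem WeightedAutomaton.IsAmbiguousBy.exists_equivalent {α R Q : Type*} [Finite α] [Finite Q]
    {A : WeightedAutomaton α R Q} (hA : A.IsAperiodic) {k : ℕ} (hk : A.IsAmbiguousBy k) :
    ∃ Φ : WFO α R, Φ.IsSentence ∧ Φ.NoFirstOrderSum ∧ (k ≤ 1 → Φ.NoBinarySum) ∧
      A.Equivalent Φ := by
  have hk' (u : List α) (hu : u ≠ []) : (A.successfulRuns u).ncard ≤ k := by
    have := hk u hu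
    rwa [← (A.finite_successfulRuns u).cast_ncard_eq, Nat.cast_le] at this
  cases isEmpty_or_nonempty R
  -- Without weights there are no transitions, hence no runs on nonempty words.
  · refine ⟨.zero, rfl, trivial, fun _ => trivial, fun u hu σ => ?_⟩
    have he : A.successfulRuns u = ∅ := by
      refine Set.eq_empty_of_forall_notMem ?_
      rintro (_ | ⟨τ, ρ⟩) ⟨p, -, q, -, h⟩
      · exact hu h.2.symm
      · exact isEmptyElim (A.wgt τ)
    have hr : Set.range (fun i : Fin 0 => ([] : List A.trans)) = A.successfulRuns u := by
      simp [he]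
    rw [sem_eq_sum hu (Function.injective_of_subsingleton _) hr, WFO.sem]
    simp
  · obtain ⟨Φ, h1, h2, h3, h4⟩ := exists_sem_eq hA k
    exact ⟨Φ, h1, h2, h3, fun u hu => h4 u hu (hk' u hu)⟩

theorem corollary5p2 {α R Q : Type*} [Finite α] [Finite Q]
    (A : WeightedAutomaton α R Q) (hA : A.IsAperiodic) :
    (A.IsUnambiguous →
      ∃ Φ : WFO α R, Φ.IsSentence ∧ Φ.NoFirstOrderSum ∧ Φ.NoBinarySum ∧ A.Equivalent Φ) ∧
    (A.IsFinitelyAmbiguous →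
      ∃ Φ : WFO α R, Φ.IsSentence ∧ Φ.NoFirstOrderSum ∧ A.Equivalent Φ) := by
  constructor
  · intro h
    obtain ⟨Φ, h1, h2, h3, h4⟩ :=
      WeightedAutomaton.IsAmbiguousBy.exists_equivalent (k := 1) hA h
    exact ⟨Φ, h1, h2, h3 le_rfl, h4⟩
  · rintro ⟨k, h⟩
    obtain ⟨Φ, h1, h2, -, h4⟩ := h.exists_equivalent hA
    exact ⟨Φ, h1, h2, h4⟩
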